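/- Let $G$ be a countable abelian group that is unbounded, i.e. for every integer $m\ge 1$ there is $g\in G$ with $mg\neq 0$. Then $G$ admits a minimally almost periodic group topology: there is a Hausdorff topology on $G$ that makes $G$ a topological group and for which every continuous group homomorphism $G\to\mathbb{T}=\mathbb{R}/\mathbb{Z}$ is trivial. -/

import Mathlib

/-- A topological abelian group `G` is minimally almost periodic if every character of `G`
(a continuous homomorphism from `G` to the circle group `𝕋 = ℝ / ℤ`) is trivial. -/
def IsMinimallyAlmostPeriodic (G : Type*) [AddCommGroup G] [TopologicalSpace G] : Prop :=
  ∀ χ : G →+ UnitAddCircle, Continuous χ → χ = 0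

/-- An abelian group is bounded if it has finite exponent, i.e. `m G = 0` for some integer
`m ≥ 1`; it is unbounded otherwise. -/
def IsUnboundedGroup (G : Type*) [AddCommGroup G] : Prop :=
  ¬ ∃ m : ℕ, 1 ≤ m ∧ ∀ g : G, m • g = 0

open Filter Topology Finset
open scoped Pointwise

/-! List each element of `G` infinitely often and split the `n`-th entry into `2 ^ n + 1` summands
so generic that a bounded relation with a vanishing coefficient is trivial (`exists_family`).
Neighbourhoods of zero use few summands per level, with large coefficients. They separate points
(`notMem_sumNhds`), yet a character small on one has norm at most `1 / 4 / 4 ^ n` on each summand,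
hence at most `(1 / 2) ^ n` on the entry, for all large `n` (`norm_map_sum_le`). -/

/-! ### Generic families in unbounded groups -/

theorem IsUnboundedGroup.exists_zsmul_notMem {G : Type*} [AddCommGroup G]
    (hG : IsUnboundedGroup G) (F : Finset G) (M : ℕ) :
    ∃ y : G, ∀ j : ℤ, j ≠ 0 → |j| ≤ M → j • y ∉ F := by
  classical
  by_contra! hcon
  let s : Finset (ℤ × G) := ((Icc (-M : ℤ) M).filter (· ≠ 0)) ×ˢ F
  let H : ℤ × G → AddSubgroup G := fun p => (zsmulAddGroupHom p.1 : G →+ G).ker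
  let g : ℤ × G → G := fun p => if h : ∃ y : G, p.1 • y = p.2 then h.choose else 0
  have hcov : ⋃ p ∈ s, g p +ᵥ (H p : Set G) = Set.univ := by
    refine Set.eq_univ_of_forall fun y => ?_
    obtain ⟨j, hj0, hjM, hjF⟩ := hcon y
    have hex : ∃ z : G, j • z = j • y := ⟨y, rfl⟩
    have hg : j • g (j, j • y) = j • y := by
      simp only [g, dif_pos hex]
      exact hex.choose_spec
    simp only [Set.mem_iUnion]
    refine ⟨(j, j • y), ?_, ?_⟩
    · rw [abs_le] at hjM
      simp [s, hj0, hjM, hjF]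
    · rw [Set.mem_vadd_set_iff_neg_vadd_mem]
      simp only [H, SetLike.mem_coe, AddMonoidHom.mem_ker, vadd_eq_add, zsmulAddGroupHom_apply,
        smul_add, smul_neg, hg]
      abel
  -- B. H. Neumann's lemma: some kernel of multiplication by `j` has finite index, so `j` times that
  -- index kills `G`.
  obtain ⟨⟨j, f⟩, hks, hk⟩ := AddSubgroup.exists_finiteIndex_of_leftCoset_cover hcov
  have hj0 : j ≠ 0 := by
    simp only [s, mem_product, mem_filter] at hks
    exact hks.1.2
  refine hG ⟨j.natAbs * (H (j, f)).index, ?_, fun a => ?_⟩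
  · exact Nat.one_le_iff_ne_zero.2 (mul_ne_zero (by simpa using hj0) hk.index_ne_zero)
  · have h1 : (H (j, f)).index • a ∈ H (j, f) := AddSubgroup.nsmul_index_mem _ a
    have h2 : j • (H (j, f)).index • a = 0 := h1
    rw [mul_smul]
    generalize (H (j, f)).index • a = b at h2 ⊢
    rcases Int.natAbs_eq j with h | h <;> rw [h] at h2
    · rwa [natCast_zsmul] at h2
    · rwa [neg_smul, natCast_zsmul, neg_eq_zero] at h2

/-- The integral combinations of a finite family with coefficients of size at most `M`. -/
noncomputable def boundedSums {G ι : Type*} [AddCommGroup G] [Fintype ι]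
    (x : ι → G) (M : ℕ) : Set G :=
  (fun c : ι → ℤ => ∑ i, c i • x i) '' Set.univ.pi fun _ => Set.Icc (-M : ℤ) M

theorem boundedSums_finite {G ι : Type*} [AddCommGroup G] [Fintype ι]
    (x : ι → G) (M : ℕ) : (boundedSums x M).Finite :=
  (Set.Finite.pi fun _ => Set.finite_Icc _ _).image _

theorem mem_boundedSums {G ι : Type*} [AddCommGroup G] [Fintype ι]
    {x : ι → G} {M : ℕ} {c : ι → ℤ} (hc : ∀ i, |c i| ≤ M) : ∑ i, c i • x i ∈ boundedSums x M :=
  ⟨c, fun i _ => abs_le.1 (hc i), rfl⟩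

theorem IsUnboundedGroup.exists_independent {G : Type*} [AddCommGroup G]
    (hG : IsUnboundedGroup G) (M k : ℕ) {F : Set G} (hF : F.Finite) :
    ∃ y : Fin k → G, ∀ c : Fin k → ℤ, (∀ i, |c i| ≤ M) → ∑ i, c i • y i ∈ F → c = 0 := by
  induction k with
  | zero => exact ⟨0, fun c _ _ => Subsingleton.elim _ _⟩
  | succ k ih =>
    obtain ⟨y, hy⟩ := ih
    have hF' : (F - boundedSums y M).Finite := hF.sub (boundedSums_finite y M)
    obtain ⟨z, hz⟩ := hG.exists_zsmul_notMem hF'.toFinset M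
    refine ⟨Fin.cons z y, fun c hc hcF => ?_⟩
    rw [Fin.sum_univ_succ] at hcF
    simp only [Fin.cons_zero, Fin.cons_succ] at hcF
    have h0 : c 0 = 0 := by
      by_contra h
      refine hz _ h (hc 0) (hF'.mem_toFinset.2 ?_)
      exact ⟨_, hcF, _, mem_boundedSums (c := fun i => c i.succ) fun i => hc _, by simp⟩
    rw [h0, zero_smul, zero_add] at hcF
    have h1 := hy (fun i => c i.succ) (fun i => hc _) hcF
    funext i
    exact Fin.cases h0 (fun i => congrFun h1 i) i

theorem IsUnboundedGroup.exists_sum_eq {G : Type*} [AddCommGroup G]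
    (hG : IsUnboundedGroup G) (M k : ℕ) (g : G) {F : Set G} (hF : F.Finite) :
    ∃ x : Fin (k + 1) → G, ∑ i, x i = g ∧
      ∀ c : Fin (k + 1) → ℤ, (∀ i, |c i| ≤ M) → (∃ i, c i = 0) → ∑ i, c i • x i ∈ F → c = 0 := by
  obtain ⟨y, hy⟩ := hG.exists_independent (2 * M) k
    (hF.sub (boundedSums_finite (fun _ : Unit => g) M))
  refine ⟨Fin.cons (g - ∑ i, y i) y, by simp [Fin.sum_univ_succ], fun c hc hc0 hcF => ?_⟩
  rw [Fin.sum_univ_succ] at hcF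
  simp only [Fin.cons_zero, Fin.cons_succ] at hcF
  -- The sum is `c 0 • g + ∑ (c i.succ - c 0) • y i`; differences are bounded by `2 * M`, so all
  -- coefficients agree, and one is zero.
  have h := hy (fun i => c i.succ - c 0) (fun i => ?_) ?_
  · have h' : ∀ i, c i = c 0 := fun i =>
      Fin.cases rfl (fun i => sub_eq_zero.1 (congrFun h i)) i
    obtain ⟨i, hi⟩ := hc0
    funext j
    rw [h' j, ← h' i, hi, Pi.zero_apply]
  · have h1 := abs_sub (c i.succ) (c 0)
    have h2 := hc i.succ
    have h3 := hc 0
    push_cast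
    linarith
  · refine ⟨_, hcF, _, mem_boundedSums (x := fun _ : Unit => g) (c := fun _ => c 0)
      (fun _ => hc 0), ?_⟩
    simp only [univ_unique, sum_const, card_singleton, one_smul, sub_smul, sum_sub_distrib,
      smul_sub, ← smul_sum]
    abel

theorem IsUnboundedGroup.exists_family {G : Type*} [AddCommGroup G]
    (hG : IsUnboundedGroup G) (e f : ℕ → G) :
    ∃ x : ∀ n, Fin (2 ^ n + 1) → G, (∀ n, ∑ i, x n i = f n) ∧
      ∀ n r, r ≤ n → ∀ c : Fin (2 ^ n + 1) → ℤ, (∀ i, |c i| ≤ (8 ^ n : ℕ)) → (∃ i, c i = 0) →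
      ∀ s : ℕ → G, (∀ l, s l ∈ boundedSums (x l) (8 ^ l)) →
      ∑ i, c i • x n i = e r - ∑ l ∈ range n, s l → c = 0 := by
  choose X hXsum hX using fun (n : ℕ) (P : {P : Set G // P.Finite}) =>
    hG.exists_sum_eq (8 ^ n) (2 ^ n) (f n) (((Set.finite_Iic n).image e).sub P.2)
  -- `P n` collects all sums from the levels below `n`.
  let P : ℕ → {P : Set G // P.Finite} := fun n =>
    Nat.rec ⟨{0}, Set.finite_singleton 0⟩
      (fun n Q => ⟨Q.1 + boundedSums (X n Q) (8 ^ n), Q.2.add (boundedSums_finite _ _)⟩) n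
  have hP : ∀ s : ℕ → G, (∀ l, s l ∈ boundedSums (X l (P l)) (8 ^ l)) →
      ∀ n, ∑ l ∈ range n, s l ∈ (P n).1 := by
    intro s hs n
    induction n with
    | zero => simp [P]
    | succ n ih =>
      rw [sum_range_succ]
      exact Set.add_mem_add ih (hs n)
  refine ⟨fun n => X n (P n), fun n => hXsum n _, fun n r hr c hc hc0 s hs heq => ?_⟩
  refine hX n (P n) c hc hc0 ?_
  rw [heq]
  exact Set.sub_mem_sub ⟨r, hr, rfl⟩ (hP s hs n)

/-! ### Sparse combinations and norms on the circle -/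

/-- The integral combinations of a finite family with at most `q` nonzero coefficients,
of size at most `q * m`. -/
def sparseSums {G ι : Type*} [AddCommGroup G] [Fintype ι]
    (x : ι → G) (m q : ℕ) : Set G :=
  {g | ∃ c : ι → ℤ, (∀ i, |c i| ≤ (q * m : ℕ)) ∧ #{i | c i ≠ 0} ≤ q ∧ ∑ i, c i • x i = g}

section sparseSums

variable {G ι : Type*} [AddCommGroup G] [Fintype ι] {x : ι → G} {m : ℕ}

theorem sparseSums_mono {q q' : ℕ} (h : q ≤ q') : sparseSums x m q ⊆ sparseSums x m q' := by
  rintro g ⟨c, hc, hcard, rfl⟩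
  exact ⟨c, fun i => (hc i).trans (by exact_mod_cast Nat.mul_le_mul_right m h),
    hcard.trans h, rfl⟩

theorem zero_mem_sparseSums (q : ℕ) : (0 : G) ∈ sparseSums x m q :=
  ⟨0, fun i => by simp only [Pi.zero_apply, abs_zero]; positivity, by simp, by simp⟩

theorem neg_mem_sparseSums {q : ℕ} {g : G} (hg : g ∈ sparseSums x m q) :
    -g ∈ sparseSums x m q := by
  obtain ⟨c, hc, hcard, rfl⟩ := hg
  exact ⟨-c, by simpa using hc, by simpa using hcard, by simp⟩

theorem add_mem_sparseSums {q q' : ℕ} {g g' : G} (hg : g ∈ sparseSums x m q)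
    (hg' : g' ∈ sparseSums x m q') : g + g' ∈ sparseSums x m (q + q') := by
  classical
  obtain ⟨c, hc, hcard, rfl⟩ := hg
  obtain ⟨d, hd, hdard, rfl⟩ := hg'
  refine ⟨c + d, fun i => ?_, ?_, by simp [add_smul, sum_add_distrib]⟩
  · have h1 := hc i
    have h2 := hd i
    have h3 := abs_add_le (c i) (d i)
    push_cast at *
    simp only [Pi.add_apply]
    linarith
  · calc #{i | (c + d) i ≠ 0} ≤ #(({i | c i ≠ 0} : Finset ι) ∪ ({i | d i ≠ 0} : Finset ι)) := by
          refine card_le_card fun i => ?_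
          simp only [mem_filter, mem_union, Finset.mem_univ, true_and, Pi.add_apply]
          contrapose!
          rintro ⟨h, h'⟩
          simp [h, h']
      _ ≤ _ := (card_union_le _ _).trans (add_le_add hcard hdard)

theorem eq_zero_of_mem_sparseSums_zero {g : G} (hg : g ∈ sparseSums x m 0) : g = 0 := by
  obtain ⟨c, hc, -, rfl⟩ := hg
  refine sum_eq_zero fun i _ => ?_
  have : c i = 0 := by simpa using hc i
  simp [this]

theorem zsmul_mem_sparseSums (i : ι) {j : ℤ} (hj : |j| ≤ m) {q : ℕ} (hq : 1 ≤ q) :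
    j • x i ∈ sparseSums x m q := by
  classical
  refine sparseSums_mono hq ⟨Pi.single i j, fun k => ?_, ?_, ?_⟩
  · by_cases h : k = i
    · subst h; simpa using hj
    · simp [h]
  · refine (card_le_card (t := {i}) fun k => ?_).trans (by simp)
    simp only [mem_filter, mem_singleton]
    rintro ⟨-, h⟩
    by_contra h'
    simp [h'] at h
  · rw [sum_eq_single i] <;> simp +contextual

end sparseSums

theorem UnitAddCircle.two_pow_mul_norm_le {a : UnitAddCircle} (n : ℕ)
    (h : ∀ k ≤ n, ‖(2 ^ k : ℕ) • a‖ ≤ 1 / 4) : 2 ^ n * ‖a‖ ≤ 1 / 4 := by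
  have double : ∀ b : UnitAddCircle, ‖b‖ ≤ 1 / 4 → ‖2 • b‖ = 2 * ‖b‖ := by
    intro b hb
    induction b using QuotientAddGroup.induction_on with
    | H t =>
      have hr : ((t : ℝ) : UnitAddCircle) = ((t - round t : ℝ) : UnitAddCircle) := by
        rw [AddCircle.coe_sub]
        have : ((round t : ℝ) : UnitAddCircle) = 0 :=
          (AddCircle.coe_eq_zero_iff 1).2 ⟨round t, by simp⟩
        rw [this, sub_zero]
      have hn : ‖((t : ℝ) : UnitAddCircle)‖ = |t - round t| := by
        simpa using UnitAddCircle.norm_eq (x := t)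
      change ‖((t : ℝ) : UnitAddCircle)‖ ≤ 1 / 4 at hb
      change ‖2 • ((t : ℝ) : UnitAddCircle)‖ = 2 * ‖((t : ℝ) : UnitAddCircle)‖
      rw [hn] at hb ⊢
      rw [hr, ← AddCircle.coe_nsmul,
        (AddCircle.norm_coe_eq_abs_iff (1 : ℝ) one_ne_zero).2] <;>
      simp only [nsmul_eq_mul, Nat.cast_ofNat, abs_mul, abs_two, abs_one]
      linarith
  have key : ∀ k ≤ n, ‖(2 ^ k : ℕ) • a‖ = 2 ^ k * ‖a‖ := by
    intro k
    induction k with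
    | zero => simp
    | succ k ih =>
      intro hk
      rw [pow_succ', mul_smul, double _ (h k (by omega)), ih (by omega)]
      ring
  rw [← key n le_rfl]
  exact h n le_rfl

/-! ### The topology -/

section sumNhds

variable {G : Type*} [AddCommGroup G] (x : ∀ n, Fin (2 ^ n + 1) → G)

/-- The basic neighbourhoods of zero attached to the family `x`. -/
def sumNhds (r : ℕ) : Set G :=
  Finsupp.liftAddHom (fun _ : ℕ => AddMonoidHom.id G) ''
    {s : ℕ →₀ G | ∀ n, s n ∈ sparseSums (x n) (4 ^ n) (2 ^ n / 2 ^ r)}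

theorem zero_mem_sumNhds (r : ℕ) : (0 : G) ∈ sumNhds x r :=
  ⟨0, fun _ => zero_mem_sparseSums _, map_zero _⟩

theorem neg_mem_sumNhds {r : ℕ} {g : G} (hg : g ∈ sumNhds x r) : -g ∈ sumNhds x r := by
  obtain ⟨s, hs, rfl⟩ := hg
  exact ⟨-s, fun n => neg_mem_sparseSums (hs n), map_neg _ _⟩

theorem sumNhds_antitone : Antitone (sumNhds x) := by
  rintro r r' h g ⟨s, hs, rfl⟩
  exact ⟨s, fun n => sparseSums_mono
    (Nat.div_le_div_left (Nat.pow_le_pow_right two_pos h) (by positivity)) (hs n), rfl⟩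

theorem add_mem_sumNhds {r : ℕ} {g g' : G} (hg : g ∈ sumNhds x (r + 1))
    (hg' : g' ∈ sumNhds x (r + 1)) : g + g' ∈ sumNhds x r := by
  obtain ⟨s, hs, rfl⟩ := hg
  obtain ⟨s', hs', rfl⟩ := hg'
  refine ⟨s + s', fun n => sparseSums_mono ?_ (add_mem_sparseSums (hs n) (hs' n)), map_add _ _ _⟩
  rw [pow_succ, ← Nat.div_div_eq_div_mul]
  -- Halving the budget: `2 * (a / 2) ≤ a`.
  omega

theorem sparseSums_subset_sumNhds (n r : ℕ) :
    sparseSums (x n) (4 ^ n) (2 ^ n / 2 ^ r) ⊆ sumNhds x r := by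
  intro g hg
  refine ⟨Finsupp.single n g, fun k => ?_, by simp⟩
  rcases eq_or_ne k n with rfl | h
  · simpa using hg
  · rw [Finsupp.single_eq_of_ne h]
    exact zero_mem_sparseSums _

/-- The group filter basis formed by the sets `sumNhds x r`. -/
abbrev sumNhdsBasis : AddGroupFilterBasis G :=
  addGroupFilterBasisOfComm (Set.range (sumNhds x)) (Set.range_nonempty _)
    (by
      rintro _ _ ⟨r, rfl⟩ ⟨r', rfl⟩
      exact ⟨_, ⟨max r r', rfl⟩, Set.subset_inter (sumNhds_antitone x (le_max_left _ _))
        (sumNhds_antitone x (le_max_right _ _))⟩)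
    (by rintro _ ⟨r, rfl⟩; exact zero_mem_sumNhds x r)
    (by
      rintro _ ⟨r, rfl⟩
      refine ⟨_, ⟨r + 1, rfl⟩, ?_⟩
      rintro _ ⟨g, hg, g', hg', rfl⟩
      exact add_mem_sumNhds x hg hg')
    (by rintro _ ⟨r, rfl⟩; exact ⟨_, ⟨r, rfl⟩, fun g hg => neg_mem_sumNhds x hg⟩)

theorem mem_sumNhdsBasis {U : Set G} : U ∈ sumNhdsBasis x ↔ ∃ r, sumNhds x r = U := Iff.rfl

variable {x}

/-- Genericity kills the top nonzero term: its level is at least `r`, since lower budgets are zero,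
and at most `2 ^ n` of its `2 ^ n + 1` coefficients are nonzero. -/
theorem notMem_sumNhds {e : ℕ → G}
    (hx : ∀ n r, r ≤ n → ∀ c : Fin (2 ^ n + 1) → ℤ, (∀ i, |c i| ≤ (8 ^ n : ℕ)) →
      (∃ i, c i = 0) → ∀ s : ℕ → G, (∀ l, s l ∈ boundedSums (x l) (8 ^ l)) →
      ∑ i, c i • x n i = e r - ∑ l ∈ range n, s l → c = 0)
    {r : ℕ} (hr : e r ≠ 0) : e r ∉ sumNhds x r := by
  rintro ⟨s, hs, hsum⟩
  have hbound : ∀ n, 2 ^ n / 2 ^ r * 4 ^ n ≤ 8 ^ n := fun n => by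
    calc 2 ^ n / 2 ^ r * 4 ^ n ≤ 2 ^ n * 4 ^ n := Nat.mul_le_mul_right _ (Nat.div_le_self _ _)
      _ = 8 ^ n := by rw [← mul_pow]; norm_num
  have hs0 : s.support.Nonempty := by
    rw [Finsupp.support_nonempty_iff]
    rintro rfl
    exact hr (by rw [← hsum, map_zero])
  set n := s.support.max' hs0
  have hn : s n ≠ 0 := Finsupp.mem_support_iff.1 (s.support.max'_mem hs0)
  have hrn : r ≤ n := by
    by_contra! h
    have h' := hs n
    rw [Nat.div_eq_of_lt (Nat.pow_lt_pow_right one_lt_two h)] at h'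
    exact hn (eq_zero_of_mem_sparseSums_zero h')
  have hrange : ∑ l ∈ range (n + 1), s l = e r := by
    rw [← hsum, Finsupp.liftAddHom_apply]
    refine (Finsupp.sum_of_support_subset s (fun l hl => ?_)
      (fun _ g => AddMonoidHom.id G g) fun _ _ => rfl).symm
    exact mem_range.2 (Nat.lt_succ_of_le (s.support.le_max' l hl))
  obtain ⟨c, hc, hcard, hcs⟩ := hs n
  refine hn ?_
  rw [← hcs, hx n r hrn c (fun i => (hc i).trans (by exact_mod_cast hbound n)) ?_ s ?_ ?_]
  · simp
  · by_contra! h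
    have h1 : #{i | c i ≠ 0} = 2 ^ n + 1 := by simp [h]
    have := Nat.div_le_self (2 ^ n) (2 ^ r)
    omega
  · intro l
    obtain ⟨d, hd, -, hds⟩ := hs l
    rw [← hds]
    exact mem_boundedSums fun i => (hd i).trans (by exact_mod_cast hbound l)
  · rw [hcs, eq_sub_iff_add_eq, ← hrange, sum_range_succ, add_comm]

theorem norm_map_sum_le {χ : G →+ UnitAddCircle} {r : ℕ}
    (hχ : ∀ g ∈ sumNhds x r, ‖χ g‖ ≤ 1 / 4) {n : ℕ} (hn : r ≤ n) :
    ‖χ (∑ i, x n i)‖ ≤ (1 / 2) ^ n := by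
  have h1 : ∀ i, ‖χ (x n i)‖ ≤ 1 / 4 / 4 ^ n := fun i => by
    have := UnitAddCircle.two_pow_mul_norm_le (a := χ (x n i)) (2 * n) fun k hk => by
      rw [← map_nsmul, ← natCast_zsmul]
      refine hχ _ (sparseSums_subset_sumNhds x n r (zsmul_mem_sparseSums i ?_ ?_))
      · rw [Nat.abs_cast]
        have : 2 ^ k ≤ 4 ^ n := by
          calc 2 ^ k ≤ 2 ^ (2 * n) := Nat.pow_le_pow_right two_pos hk
            _ = 4 ^ n := by rw [pow_mul]; norm_num
        exact_mod_cast this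
      · exact (Nat.one_le_div_iff (by positivity)).2 (Nat.pow_le_pow_right two_pos hn)
    rw [le_div_iff₀ (by positivity), mul_comm]
    rw [pow_mul] at this
    norm_num at this ⊢
    exact this
  calc ‖χ (∑ i, x n i)‖ ≤ ∑ i, ‖χ (x n i)‖ := by rw [map_sum]; exact norm_sum_le _ _
    _ ≤ ∑ _i : Fin (2 ^ n + 1), 1 / 4 / 4 ^ n := sum_le_sum fun i _ => h1 i
    _ = (2 ^ n + 1) * (1 / 4) * ((1 / 2) ^ n * (1 / 2) ^ n) := by
      rw [← mul_pow, sum_const, card_univ, Fintype.card_fin, nsmul_eq_mul, div_eq_mul_inv, ← inv_pow]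
      push_cast
      norm_num
      ring
    _ ≤ (2 ^ n + 2 ^ n) * (1 / 4) * ((1 / 2) ^ n * (1 / 2) ^ n) := by
      gcongr; exact one_le_pow₀ one_le_two
    _ = (2 * (1 / 2)) ^ n * (1 / 2) * (1 / 2) ^ n := by rw [mul_pow]; ring
    _ ≤ (1 / 2) ^ n := by
      have : (0 : ℝ) < (1 / 2) ^ n := by positivity
      norm_num at this ⊢

end sumNhds

theorem lemma9p1 (G : Type*) [AddCommGroup G] [Countable G] (hG : IsUnboundedGroup G) :
    ∃ _ : TopologicalSpace G,
      IsTopologicalAddGroup G ∧ T2Space G ∧ IsMinimallyAlmostPeriodic G := by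
  obtain ⟨e, he⟩ := exists_surjective_nat G
  obtain ⟨x, hsum, hx⟩ := hG.exists_family e fun n => e n.unpair.1
  let B := sumNhdsBasis x
  let _ := B.topology
  have : IsTopologicalAddGroup G := B.isTopologicalAddGroup
  refine ⟨B.topology, this, ?_, ?_⟩
  · refine IsTopologicalAddGroup.t2Space_of_zero_sep fun g hg => ?_
    obtain ⟨r, rfl⟩ := he g
    exact ⟨_, B.mem_nhds_zero ((mem_sumNhdsBasis x).2 ⟨r, rfl⟩), notMem_sumNhds hx hg⟩
  · intro χ hχ
    have hball : χ ⁻¹' Metric.closedBall 0 (1 / 4) ∈ 𝓝 (0 : G) :=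
      hχ.continuousAt.preimage_mem_nhds (by
        rw [map_zero]; exact Metric.closedBall_mem_nhds _ (by norm_num))
    obtain ⟨_, hU, hsub⟩ := B.nhds_zero_hasBasis.mem_iff.1 hball
    obtain ⟨r, rfl⟩ := (mem_sumNhdsBasis x).1 hU
    have hr : ∀ g ∈ sumNhds x r, ‖χ g‖ ≤ 1 / 4 := fun g hg => by simpa using hsub hg
    ext g
    obtain ⟨a, rfl⟩ := he g
    -- `e a` is the entry at every level `Nat.pair a b`.
    have hle : ∀ᶠ b : ℕ in atTop, ‖χ (e a)‖ ≤ (1 / 2 : ℝ) ^ b := by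
      filter_upwards [eventually_ge_atTop r] with b hb
      have hab : b ≤ Nat.pair a b := Nat.right_le_pair a b
      have := norm_map_sum_le hr (hb.trans hab)
      rw [hsum, Nat.unpair_pair] at this
      exact this.trans (pow_le_pow_of_le_one (by norm_num) (by norm_num) hab)
    have h0 : ‖χ (e a)‖ ≤ 0 := ge_of_tendsto
      (tendsto_pow_atTop_nhds_zero_of_lt_one (by norm_num) (by norm_num)) hle
    simpa using h0
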